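/- Let $(R,\mathfrak m,k)$ be a commutative Noetherian local ring and let $\mathfrak a$ be a proper ideal of $R$. Let $\mathrm D_\sqsubset(R)$ be the full subcategory of the derived category $\mathrm D(R)$ of $R$-modules consisting of the complexes $X$ with $\mathrm H_i(X)=0$ for all $i\gg 0$ (homological grading). Let $\mathbf R\Gamma_{\mathfrak a}$ be the right derived functor of $\Gamma_{\mathfrak a}(N)=\{x\in N\mid \mathfrak a^n x=0\text{ for some }n\ge 0\}$. For $X\in\mathrm D_\sqsubset(R)$ set $$\operatorname{depth}_R X=-\sup\{j\in\mathbb Z\mid \mathrm H_j(\mathbf R\mathrm{Hom}_R(k,X))\neq 0\}\in\mathbb Z\cup\{\pm\infty\}$$ (so $\operatorname{depth}_RX=\infty$ if $\mathbf R\mathrm{Hom}_R(k,X)\simeq 0$) and, for $i\in\mathbb Z$, $$\mu^i_R(X)=\operatorname{rank}_k \mathrm H_{-i}(\mathbf R\mathrm{Hom}_R(k,X)),$$ a cardinal number; for a prime ideal $\mathfrak p$ of $R$ set $\mu^i(\mathfrak p,X)=\mu^i_{R_{\mathfrak p}}(X_{\mathfrak p})$. Then for every $M\in\mathrm D_\sqsubset(R)$: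 1. $\mathbf R\mathrm{Hom}_R(k,\mathbf R\Gamma_{\mathfrak a}(M))\simeq\mathbf R\mathrm{Hom}_R(k,M)$ in $\mathrm D(R)$; 2. $\operatorname{depth}_R\mathbf R\Gamma_{\mathfrak a}(M)=\operatorname{depth}_R M$; 3. $\mu^i_R(\mathbf R\Gamma_{\mathfrak a}(M))=\mu^i_R(M)$ for all $i\in\mathbb Z$, and, for every prime ideal $\mathfrak p\supseteq\mathfrak a$, $\mu^i(\mathfrak p,\mathbf R\Gamma_{\mathfrak a}(M))=\mu^i(\mathfrak p,M)$ for all $i\in\mathbb Z$. -/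

import Mathlib

open CategoryTheory

universe w w' u

noncomputable section

namespace LocalSection

variable {R : Type u} [CommRing R]

/-- The submodule `{x ∈ M | 𝔞ⁿ x = 0 for some n}` of elements supported at the ideal `𝔞`. -/
def gammaSubmodule (𝔞 : Ideal R) (M : Type u) [AddCommGroup M] [Module R M] : Submodule R M where
  carrier := {x | ∃ n : ℕ, ∀ r ∈ 𝔞 ^ n, r • x = 0}
  zero_mem' := ⟨0, fun r _ => smul_zero r⟩
  add_mem' := by
    rintro x y ⟨m, hm⟩ ⟨n, hn⟩
    refine ⟨max m n, fun r hr => ?_⟩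
    rw [smul_add, hm r (Ideal.pow_le_pow_right (le_max_left m n) hr),
      hn r (Ideal.pow_le_pow_right (le_max_right m n) hr), add_zero]
  smul_mem' := by
    rintro c x ⟨n, hn⟩
    exact ⟨n, fun r hr => by rw [smul_comm, hn r hr, smul_zero]⟩

/-- The section functor `Γ_𝔞` on `R`-modules. -/
def gamma (𝔞 : Ideal R) : ModuleCat.{u} R ⥤ ModuleCat.{u} R where
  obj M := ModuleCat.of R (gammaSubmodule 𝔞 M)
  map {M N} f := ModuleCat.ofHom (f.hom.restrict (p := gammaSubmodule 𝔞 M)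
    (q := gammaSubmodule 𝔞 N) (by
      rintro x ⟨n, hn⟩
      exact ⟨n, fun r hr => by rw [← map_smul, hn r hr, map_zero]⟩))

instance (𝔞 : Ideal R) : (gamma 𝔞).Additive where

section Derived

variable [HasDerivedCategory.{w} (ModuleCat.{u} R)]

/-- The right derived section functor `RΓ_𝔞` on the homologically left-bounded derived category
`D_⊏(R)` (no cohomology in sufficiently negative cohomological degrees). On (the image of) a
bounded below complex `E` of injective modules it is given by `Γ_𝔞(E)`. -/
abbrev RGamma (𝔞 : Ideal R) :
    DerivedCategory.Plus (ModuleCat.{u} R) ⥤ DerivedCategory.Plus (ModuleCat.{u} R) :=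
  (gamma 𝔞).rightDerivedFunctorPlus

/-- The functor `Hom_R(N, -)` from `R`-modules to `R`-modules. -/
abbrev homFrom (N : ModuleCat.{u} R) : ModuleCat.{u} R ⥤ ModuleCat.{u} R :=
  (linearCoyoneda R (ModuleCat.{u} R)).obj (Opposite.op N)

/-- The functor `RHom_R(N, -)` on `D_⊏(R)`, for an `R`-module `N`. -/
abbrev RHom (N : ModuleCat.{u} R) :
    DerivedCategory.Plus (ModuleCat.{u} R) ⥤ DerivedCategory.Plus (ModuleCat.{u} R) :=
  (homFrom N).rightDerivedFunctorPlus

/-- The residue field `k` of a local ring, as an `R`-module. -/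
abbrev resField (R : Type u) [CommRing R] [IsLocalRing R] : ModuleCat.{u} R :=
  ModuleCat.of R (IsLocalRing.ResidueField R)

/-- The module `Hⁱ(RHom_R(k, X))`, which in homological notation is `H_{-i}(RHom_R(k, X))`. -/
abbrev extResField [IsLocalRing R] (X : DerivedCategory.Plus (ModuleCat.{u} R)) (i : ℤ) :
    ModuleCat.{u} R :=
  (DerivedCategory.Plus.homologyFunctor (ModuleCat.{u} R) i).obj ((RHom (resField R)).obj X)

/-- `depth_R X = - sup RHom_R(k, X)`, i.e. the infimum in `ℤ ∪ {±∞}` of the integers `i` with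
`Hⁱ(RHom_R(k, X)) ≠ 0`. -/
def depth [IsLocalRing R] (X : DerivedCategory.Plus (ModuleCat.{u} R)) : WithBot (WithTop ℤ) :=
  sInf {d | ∃ i : ℤ, d = ((i : WithTop ℤ) : WithBot (WithTop ℤ)) ∧ Nontrivial (extResField X i)}

/-- The maximal ideal kills `Hⁱ(RHom_R(k, X))`. -/
lemma extResField_isTorsionBySet [IsLocalRing R]
    (X : DerivedCategory.Plus (ModuleCat.{u} R)) (i : ℤ) :
    Module.IsTorsionBySet R (extResField X i) (IsLocalRing.maximalIdeal R : Set R) := by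
  obtain ⟨n, hn⟩ := X.property
  have : X.IsGE n := (X.isGE_ι_obj_iff n).1 hn
  obtain ⟨L, -, ⟨e⟩⟩ := DerivedCategory.Plus.exists_injective_nonempty_iso X n
  let F := homFrom (resField R)
  let I := (InjectiveObject.ι (ModuleCat.{u} R)).mapCochainComplexPlus.obj L
  let K : CochainComplex (ModuleCat.{u} R) ℤ :=
    (F.mapHomologicalComplex (ComplexShape.up ℤ)).obj I.obj
  have e1 : (RHom (resField R)).obj X ≅ DerivedCategory.Plus.Qh.obj
      (F.mapHomotopyCategoryPlus.obj ((HomotopyCategory.Plus.quotient _).obj I)) :=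
    (RHom (resField R)).mapIso e.symm ≪≫
      (asIso (F.rightDerivedFunctorPlusUnit.app ((HomotopyCategory.Plus.quotient _).obj I))).symm
  have e2 : DerivedCategory.Plus.ι.obj (DerivedCategory.Plus.Qh.obj
      (F.mapHomotopyCategoryPlus.obj ((HomotopyCategory.Plus.quotient _).obj I))) ≅
      DerivedCategory.Q.obj K := (DerivedCategory.quotientCompQhIso _).app K
  have e3 : extResField X i ≅ K.homology i :=
    (DerivedCategory.homologyFunctor _ i).mapIso (DerivedCategory.Plus.ι.mapIso e1 ≪≫ e2) ≪≫
      (DerivedCategory.homologyFunctorFactors _ i).app K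
  rintro x ⟨r, hr⟩
  have h (j : ℤ) : r • 𝟙 (K.X j) = 0 := by
    ext f
    let g : resField R ⟶ I.obj.X j := f
    change r • g = 0
    ext y
    rw [ModuleCat.hom_smul, LinearMap.smul_apply, ← map_smul]
    have hy : r • y = 0 := by
      rw [Algebra.smul_def, IsLocalRing.ResidueField.algebraMap_eq,
        (IsLocalRing.residue_eq_zero_iff r).2 hr, zero_mul]
    rw [hy, map_zero, ModuleCat.hom_zero, LinearMap.zero_apply]
  have h0 : r • 𝟙 (K.sc i) = 0 := by
    ext1
    exacts [h _, h _, h _]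
  have h1 : r • 𝟙 (K.sc i).homology = 0 := by
    have := ShortComplex.homologyMap_smul (𝟙 (K.sc i)) r
    rw [h0] at this
    simpa using this.symm
  apply e3.toLinearEquiv.injective
  rw [map_smul, map_zero]
  exact congrArg (fun φ => φ.hom (e3.toLinearEquiv x)) h1

/-- The `i`-th Bass number `μⁱ_R(X) = rank_k H_{-i}(RHom_R(k, X))`, a cardinal. -/
def bassNumber [IsLocalRing R] (X : DerivedCategory.Plus (ModuleCat.{u} R)) (i : ℤ) :
    Cardinal.{u} :=
  letI : Module (IsLocalRing.ResidueField R) (extResField X i) :=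
    (extResField_isTorsionBySet X i).module
  Module.rank (IsLocalRing.ResidueField R) (extResField X i)

/-- The localization `X_𝔭`, obtained by applying the exact functor `(-)_𝔭` to complexes. -/
def localize (𝔭 : Ideal R) [𝔭.IsPrime]
    [HasDerivedCategory.{w'} (ModuleCat.{u} (Localization.AtPrime 𝔭))]
    (X : DerivedCategory.Plus (ModuleCat.{u} R)) :
    DerivedCategory.Plus (ModuleCat.{u} (Localization.AtPrime 𝔭)) where
  obj := (ModuleCat.localizedModuleFunctor 𝔭.primeCompl).mapDerivedCategory.obj X.obj
  property := by
    obtain ⟨n, ⟨K, e, _⟩⟩ := X.property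
    exact ⟨n, ⟨_, (ModuleCat.localizedModuleFunctor 𝔭.primeCompl).mapDerivedCategory.mapIso e ≪≫
      (ModuleCat.localizedModuleFunctor 𝔭.primeCompl).mapDerivedCategoryFactors.app K,
      inferInstance⟩⟩

/-- The Bass number `μⁱ(𝔭, X) = μⁱ_{R_𝔭}(X_𝔭)`. -/
def bassNumberAt (𝔭 : Ideal R) [𝔭.IsPrime]
    [HasDerivedCategory.{w'} (ModuleCat.{u} (Localization.AtPrime 𝔭))]
    (X : DerivedCategory.Plus (ModuleCat.{u} R)) (i : ℤ) : Cardinal.{u} :=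
  bassNumber (localize 𝔭 X) i

end Derived

end LocalSection

end

namespace LocalSection

variable {R : Type u} [CommRing R]

/-! Represent `M` by a bounded below complex `K` of injectives. Over a Noetherian ring `Γ_𝔞`
preserves injectives (Baer's criterion and Artin–Rees), so `Γ_𝔞(K)` is a complex of injectives
representing `RΓ_𝔞(M)`, and `RHom(k, -)` of both objects is computed by applying `Hom(k, -)`
termwise. Any map `k → E` has image killed by `𝔪 ⊇ 𝔞`, hence factors through `Γ_𝔞(E)`; so `Γ_𝔞(K) →
K`, in general no quasi-isomorphism, becomes an isomorphism of complexes under `Hom(k, -)`. Depth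
and Bass numbers depend only on `RHom(k, -)`.

At `𝔭 ⊇ 𝔞` the same argument runs over `R_𝔭`: localization preserves injectives, and elements of
`E_𝔭` killed by `𝔭R_𝔭` come from elements of `E` killed by `𝔭`. -/

/-- The image in `Γ_𝔞(M)` of a finitely generated module is killed by a power of `𝔞`. -/
lemma exists_pow_smul_eq_zero_of_finite (𝔞 : Ideal R) {M N : Type u} [AddCommGroup M] [Module R M]
    [AddCommGroup N] [Module R N] [Module.Finite R N] (g : N →ₗ[R] gammaSubmodule 𝔞 M) :
    ∃ n : ℕ, ∀ r ∈ 𝔞 ^ n, ∀ x : N, r • g x = 0 := by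
  obtain ⟨s, hs⟩ := Module.Finite.fg_top (R := R) (M := N)
  have h (x : N) : ∃ n : ℕ, ∀ r ∈ 𝔞 ^ n, r • g x = 0 := by
    obtain ⟨n, hn⟩ := (g x).2
    exact ⟨n, fun r hr => Subtype.ext (hn r hr)⟩
  choose n hn using h
  refine ⟨s.sup n, fun r hr x => ?_⟩
  have hx : x ∈ Submodule.span R (s : Set N) := hs ▸ Submodule.mem_top
  induction hx using Submodule.span_induction with
  | mem x hx => exact hn x r (Ideal.pow_le_pow_right (Finset.le_sup (f := n) hx) hr)
  | zero => simp
  | add x y _ _ hx hy => rw [map_add, smul_add, hx, hy, add_zero]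
  | smul c x _ hx => rw [map_smul, smul_comm, hx, smul_zero]

/-- Over a Noetherian ring, `Γ_𝔞` of an injective module is injective. -/
lemma injective_gammaSubmodule [IsNoetherianRing R] (𝔞 : Ideal R) (E : Type u) [AddCommGroup E]
    [Module R E] [hE : Module.Injective R E] : Module.Injective R (gammaSubmodule 𝔞 E) := by
  refine Module.Baer.injective fun I g => ?_
  obtain ⟨n, hn⟩ := exists_pow_smul_eq_zero_of_finite 𝔞 g
  -- Artin–Rees: `𝔞 ^ (n + k) ⊓ I ≤ 𝔞 ^ n • I`, and `g` kills the latter, so `g` factors through the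
  -- image of `I` in `R ⧸ J`.
  obtain ⟨k, hk⟩ := 𝔞.exists_pow_inf_eq_pow_smul (M := R) I
  let J : Ideal R := 𝔞 ^ (n + k)
  have hJ : J ⊓ I ≤ 𝔞 ^ n • I := by
    have := hk (n + k) (Nat.le_add_left k n)
    rw [Nat.add_sub_cancel] at this
    refine le_trans (le_of_eq ?_) (this.le.trans (Submodule.smul_mono le_rfl inf_le_right))
    simp [J]
  let p : I →ₗ[R] R ⧸ J := J.mkQ ∘ₗ I.subtype
  have hp : LinearMap.ker p ≤ LinearMap.ker g := by
    intro x hx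
    have hx' : (x : R) ∈ 𝔞 ^ n • I := by
      refine hJ ⟨?_, x.2⟩
      exact (Submodule.Quotient.mk_eq_zero J).1 hx
    obtain ⟨y, hy, hyx⟩ : ∃ y : I, y ∈ 𝔞 ^ n • (⊤ : Submodule R I) ∧ I.subtype y = x := by
      have : (x : R) ∈ (𝔞 ^ n • (⊤ : Submodule R I)).map I.subtype := by
        rwa [Submodule.map_smul'', Submodule.map_top, Submodule.range_subtype]
      exact this
    obtain rfl : y = x := Subtype.ext hyx
    rw [LinearMap.mem_ker]
    refine Submodule.smul_induction_on hy (fun r hr z _ => ?_) (fun a b ha hb => ?_)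
    · rw [map_smul, hn r hr z]
    · rw [map_add, ha, hb, add_zero]
  -- Injectivity of `E` extends the factored map from `I ⧸ ker p` to `R ⧸ J`. Since `J` kills `R ⧸
  -- J`, the extension takes values in `Γ_𝔞(E)`.
  obtain ⟨h, hh⟩ := hE.out ((LinearMap.ker p).liftQ p le_rfl)
    (LinearMap.ker_eq_bot.1 (Submodule.ker_liftQ_eq_bot _ _ _ le_rfl))
    ((LinearMap.ker p).liftQ ((gammaSubmodule 𝔞 E).subtype ∘ₗ g) (fun x hx => by
      have : g x = 0 := hp hx
      simp [this]))
  refine ⟨(h ∘ₗ J.mkQ).codRestrict _ fun c => ⟨n + k, fun r hr => ?_⟩, fun x hx => ?_⟩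
  · rw [← map_smul]
    have : r • c ∈ J := J.mul_mem_right c hr
    change h (Submodule.Quotient.mk (r • c)) = 0
    rw [(Submodule.Quotient.mk_eq_zero J).2 this, map_zero]
  · apply Subtype.ext
    exact hh (Submodule.Quotient.mk ⟨x, hx⟩)

instance [IsNoetherianRing R] (𝔞 : Ideal R) : (gamma 𝔞).PreservesInjectiveObjects where
  injective_obj E {hE} := by
    rw [← Module.injective_iff_injective_object] at hE ⊢
    exact injective_gammaSubmodule 𝔞 E

/-! ### Termwise comparison under `Hom(k, -)` -/

/-- The inclusion `Γ_𝔞(M) → M`. -/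
def gammaι (𝔞 : Ideal R) : gamma 𝔞 ⟶ 𝟭 (ModuleCat.{u} R) where
  app M := ModuleCat.ofHom (gammaSubmodule 𝔞 M).subtype

/-- `Hom_R(k, f)` is an isomorphism if `f` is injective and its image contains all elements which
are killed by the maximal ideal. -/
lemma isIso_homFrom_resField_map [IsLocalRing R] {A B : ModuleCat.{u} R} (f : A ⟶ B)
    (hf : Function.Injective f.hom)
    (hf' : ∀ b : B, (∀ r ∈ IsLocalRing.maximalIdeal R, r • b = 0) → b ∈ LinearMap.range f.hom) :
    IsIso ((homFrom (resField R)).map f) := by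
  rw [ConcreteCategory.isIso_iff_bijective]
  constructor
  · intro (φ : resField R ⟶ A) (ψ : resField R ⟶ A) (h : φ ≫ f = ψ ≫ f)
    refine ModuleCat.hom_ext (LinearMap.ext fun x => ?_)
    exact hf (congrArg (fun g => g.hom x) h)
  · intro (φ : resField R ⟶ B)
    have hφ (x : resField R) : φ.hom x ∈ LinearMap.range f.hom := by
      refine hf' _ fun r hr => ?_
      rw [← map_smul]
      have hx : r • x = 0 := by
        rw [Algebra.smul_def, IsLocalRing.ResidueField.algebraMap_eq,
          (IsLocalRing.residue_eq_zero_iff r).2 hr, zero_mul]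
      rw [hx, map_zero]
    let e := LinearEquiv.ofInjective f.hom hf
    let ψ : resField R ⟶ A := ModuleCat.ofHom (e.symm.toLinearMap ∘ₗ φ.hom.codRestrict _ hφ)
    refine ⟨ψ, ?_⟩
    change ψ ≫ f = φ
    ext x
    exact congrArg Subtype.val (e.apply_symm_apply ⟨φ.hom x, hφ x⟩)

lemma isIso_homFrom_resField_map_gammaι [IsLocalRing R] (𝔞 : Ideal R) (h𝔞 : 𝔞 ≠ ⊤)
    (A : ModuleCat.{u} R) : IsIso ((homFrom (resField R)).map ((gammaι 𝔞).app A)) := by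
  refine isIso_homFrom_resField_map _ Subtype.val_injective fun b hb => ?_
  refine ⟨⟨b, 1, fun r hr => hb r ?_⟩, rfl⟩
  rw [pow_one] at hr
  exact IsLocalRing.le_maximalIdeal h𝔞 hr

/-- An element of `A_𝔭` which is killed by `𝔭 R_𝔭` is a fraction `x / s` with `𝔭 x = 0`. -/
lemma exists_mk'_eq_of_maximalIdeal_smul_eq_zero (𝔭 : Ideal R) [𝔭.IsPrime] (h𝔭 : 𝔭.FG)
    {A B : Type*} [AddCommGroup A] [Module R A] [AddCommGroup B] [Module R B]
    [Module (Localization.AtPrime 𝔭) B] [IsScalarTower R (Localization.AtPrime 𝔭) B]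
    (β : A →ₗ[R] B) [IsLocalizedModule 𝔭.primeCompl β] (b : B)
    (hb : ∀ r ∈ IsLocalRing.maximalIdeal (Localization.AtPrime 𝔭), r • b = 0) :
    ∃ (x : A) (s : 𝔭.primeCompl), (∀ r ∈ 𝔭, r • x = 0) ∧ IsLocalizedModule.mk' β x s = b := by
  obtain ⟨⟨y, s⟩, hy⟩ := IsLocalizedModule.mk'_surjective 𝔭.primeCompl β b
  obtain rfl : IsLocalizedModule.mk' β y s = b := hy
  obtain ⟨G, hG⟩ := h𝔭
  have hr (r : R) (hr : r ∈ 𝔭) : ∃ t : 𝔭.primeCompl, t • r • y = 0 := by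
    have h1 := hb (algebraMap R _ r)
      ((IsLocalization.AtPrime.to_map_mem_maximal_iff _ 𝔭 r).2 hr)
    rw [algebraMap_smul, ← IsLocalizedModule.mk'_smul, IsLocalizedModule.mk'_eq_zero'] at h1
    exact h1
  choose! t ht using hr
  have hG' : (G : Set R) ⊆ 𝔭 := hG ▸ Submodule.subset_span
  -- Each generator `r` of `𝔭` needs its own denominator `t r`; as there are finitely many, their
  -- product serves for all.
  let T : 𝔭.primeCompl := ∏ r ∈ G, t r
  refine ⟨T • y, T * s, fun r hr => ?_, IsLocalizedModule.mk'_cancel_left β y T s⟩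
  rw [← hG] at hr
  induction hr using Submodule.span_induction with
  | mem r hr =>
    obtain ⟨c, hc⟩ : t r ∣ T := Finset.dvd_prod_of_mem t hr
    rw [hc, mul_comm, mul_smul, smul_comm r c, smul_comm r (t r), ht r (hG' hr), smul_zero]
  | zero => simp
  | add a b _ _ ha hb => rw [add_smul, ha, hb, add_zero]
  | smul c a _ ha => rw [smul_assoc, ha, smul_zero]

/-- Localization keeps the inclusion injective, and a numerator killed by `𝔭` is killed by `𝔞 ≤ 𝔭`,
so it already lies in `Γ_𝔞(A)`. -/
lemma isIso_homFrom_resField_map_localized_gammaι [IsNoetherianRing R] (𝔞 𝔭 : Ideal R) [𝔭.IsPrime]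
    (h : 𝔞 ≤ 𝔭) (A : ModuleCat.{u} R) :
    IsIso ((homFrom (resField (Localization.AtPrime 𝔭))).map
      ((ModuleCat.localizedModuleFunctor 𝔭.primeCompl).map ((gammaι 𝔞).app A))) := by
  let α := ((gamma 𝔞).obj A).localizedModuleMkLinearMap 𝔭.primeCompl
  let β := A.localizedModuleMkLinearMap 𝔭.primeCompl
  refine isIso_homFrom_resField_map _ ?_ fun b hb => ?_
  · exact IsLocalizedModule.map_injective 𝔭.primeCompl α β _ Subtype.val_injective
  · obtain ⟨x, s, hx, hs⟩ := exists_mk'_eq_of_maximalIdeal_smul_eq_zero 𝔭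
      (IsNoetherian.noetherian 𝔭) β b hb
    let z : (gamma 𝔞).obj A := ⟨x, 1, fun r hr => hx r (h (by simpa using hr))⟩
    let w : ((gamma 𝔞).obj A).localizedModule 𝔭.primeCompl := IsLocalizedModule.mk' α z s
    exact ⟨w,
      (IsLocalizedModule.map_mk' 𝔭.primeCompl α β _ z s).trans hs⟩

/-! ### Passage to the derived category -/

section Derived

open DerivedCategory

/-- The unit of the right derived functor is invertible on bounded below complexes of injectives. -/
lemma nonempty_rightDerivedFunctorPlus_obj_Q_iso {C D : Type*} [Category* C] [Category* D]
    [Abelian C] [Abelian D] [HasDerivedCategory C] [HasDerivedCategory D] (F : C ⥤ D) [F.Additive]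
    [EnoughInjectives C] (K : CochainComplex.Plus C) [∀ n, Injective (K.obj.X n)] :
    Nonempty (F.rightDerivedFunctorPlus.obj (Plus.Q.obj K) ≅
      Plus.Q.obj (F.mapCochainComplexPlus.obj K)) :=
  ⟨(asIso (F.rightDerivedFunctorPlusUnit.app ((HomotopyCategory.Plus.quotient C).obj K))).symm⟩

/-- A morphism between bounded below complexes of injective objects which becomes an isomorphism
after applying `F` termwise induces an isomorphism between the values of `RF`. -/
lemma nonempty_rightDerivedFunctorPlus_obj_iso {C D : Type*} [Category* C] [Category* D] [Abelian C]
    [Abelian D] [HasDerivedCategory C] [HasDerivedCategory D] (F : C ⥤ D) [F.Additive]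
    [EnoughInjectives C] {K L : CochainComplex.Plus C} (f : K ⟶ L)
    [∀ n, Injective (K.obj.X n)] [∀ n, Injective (L.obj.X n)]
    (hf : ∀ n, IsIso (F.map (f.hom.f n))) :
    Nonempty (F.rightDerivedFunctorPlus.obj (Plus.Q.obj K) ≅
      F.rightDerivedFunctorPlus.obj (Plus.Q.obj L)) := by
  have (n : ℤ) : IsIso (((F.mapHomologicalComplex (.up ℤ)).map f.hom).f n) := hf n
  have : IsIso ((F.mapHomologicalComplex (.up ℤ)).map f.hom) :=
    HomologicalComplex.Hom.isIso_of_components _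
  have : IsIso (F.mapCochainComplexPlus.map f) :=
    ((CochainComplex.plus D).isIso_hom_iff _).1 this
  obtain ⟨eK⟩ := nonempty_rightDerivedFunctorPlus_obj_Q_iso F K
  obtain ⟨eL⟩ := nonempty_rightDerivedFunctorPlus_obj_Q_iso F L
  exact ⟨eK ≪≫ Plus.Q.mapIso (asIso (F.mapCochainComplexPlus.map f)) ≪≫ eL.symm⟩

/-- Any object of `D_⊏` is represented by a bounded below complex of injective objects. -/
lemma exists_injective_Q_iso {C : Type*} [Category* C] [Abelian C] [HasDerivedCategory C]
    [EnoughInjectives C] (X : DerivedCategory.Plus C) :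
    ∃ (K : CochainComplex.Plus C), (∀ n, Injective (K.obj.X n)) ∧
      Nonempty (X ≅ Plus.Q.obj K) := by
  obtain ⟨n, hn⟩ := X.property
  have : X.IsGE n := (X.isGE_ι_obj_iff n).1 hn
  obtain ⟨L, -, ⟨e⟩⟩ := Plus.exists_injective_nonempty_iso X n
  exact ⟨(InjectiveObject.ι C).mapCochainComplexPlus.obj L,
    fun n => inferInstanceAs (Injective (L.obj.X n).obj), ⟨e.symm⟩⟩

instance (C D : Type*) [Category* C] [Category* D] [Abelian C] [Abelian D]
    (F : C ⥤ D) [F.Additive] [F.PreservesInjectiveObjects] (K : CochainComplex.Plus C) (n : ℤ)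
    [Injective (K.obj.X n)] : Injective ((F.mapCochainComplexPlus.obj K).obj.X n) :=
  F.injective_obj (K.obj.X n)

/-- The inclusion `Γ_𝔞(K) → K` for a bounded below complex `K`. -/
def gammaComplexι (𝔞 : Ideal R) (K : CochainComplex.Plus (ModuleCat.{u} R)) :
    (gamma 𝔞).mapCochainComplexPlus.obj K ⟶ K :=
  ObjectProperty.homMk
    { f := fun n => (gammaι 𝔞).app (K.obj.X n)
      comm' := fun i j _ => ((gammaι 𝔞).naturality (K.obj.d i j)).symm }

variable [HasDerivedCategory.{w} (ModuleCat.{u} R)]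

lemma depth_eq_of_iso [IsLocalRing R] {X Y : DerivedCategory.Plus (ModuleCat.{u} R)}
    (e : (RHom (resField R)).obj X ≅ (RHom (resField R)).obj Y) : depth X = depth Y := by
  have h (i : ℤ) : Nontrivial (extResField X i) ↔ Nontrivial (extResField Y i) :=
    ((Plus.homologyFunctor _ i).mapIso e).toLinearEquiv.toEquiv.nontrivial_congr
  simp only [depth, h]

lemma bassNumber_eq_of_iso [IsLocalRing R] {X Y : DerivedCategory.Plus (ModuleCat.{u} R)}
    (e : (RHom (resField R)).obj X ≅ (RHom (resField R)).obj Y) (i : ℤ) :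
    bassNumber X i = bassNumber Y i := by
  let φ : extResField X i ≃ₗ[R] extResField Y i :=
    ((Plus.homologyFunctor _ i).mapIso e).toLinearEquiv
  let _ : Module (IsLocalRing.ResidueField R) (extResField X i) :=
    (extResField_isTorsionBySet X i).module
  let _ : Module (IsLocalRing.ResidueField R) (extResField Y i) :=
    (extResField_isTorsionBySet Y i).module
  -- Both `k`-structures are induced from `R` along the surjection `R → k`, so `R`-linearity gives
  -- `k`-linearity.
  let ψ : extResField X i ≃ₗ[IsLocalRing.ResidueField R] extResField Y i :=
    { φ.toAddEquiv with
      map_smul' := fun c x => by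
        obtain ⟨r, rfl⟩ := IsLocalRing.residue_surjective c
        exact φ.map_smul r x }
  exact ψ.rank_eq

lemma nonempty_localize_iso (𝔭 : Ideal R) [𝔭.IsPrime]
    [HasDerivedCategory.{w'} (ModuleCat.{u} (Localization.AtPrime 𝔭))]
    {X : DerivedCategory.Plus (ModuleCat.{u} R)} {K : CochainComplex.Plus (ModuleCat.{u} R)}
    (e : X ≅ Plus.Q.obj K) :
    Nonempty (localize 𝔭 X ≅ Plus.Q.obj
      ((ModuleCat.localizedModuleFunctor 𝔭.primeCompl).mapCochainComplexPlus.obj K)) :=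
  ⟨Plus.ι.preimageIso
    ((ModuleCat.localizedModuleFunctor 𝔭.primeCompl).mapDerivedCategory.mapIso (Plus.ι.mapIso e) ≪≫
      (ModuleCat.localizedModuleFunctor 𝔭.primeCompl).mapDerivedCategoryFactors.app K.obj)⟩

/-- If a bounded below complex of injectives `K` represents `M`, then `Γ_𝔞(K)` is a complex of
injectives which represents `RΓ_𝔞(M)`. -/
lemma nonempty_RGamma_obj_iso (𝔞 : Ideal R) {M : DerivedCategory.Plus (ModuleCat.{u} R)}
    {K : CochainComplex.Plus (ModuleCat.{u} R)} [∀ n, Injective (K.obj.X n)]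
    (e : M ≅ Plus.Q.obj K) :
    Nonempty ((RGamma 𝔞).obj M ≅ Plus.Q.obj ((gamma 𝔞).mapCochainComplexPlus.obj K)) := by
  obtain ⟨e'⟩ := nonempty_rightDerivedFunctorPlus_obj_Q_iso (gamma 𝔞) K
  exact ⟨(RGamma 𝔞).mapIso e ≪≫ e'⟩

/-- `RHom_R(k, RΓ_𝔞(M)) ≅ RHom_R(k, M)`. -/
theorem nonempty_RHom_resField_RGamma_iso [IsNoetherianRing R] [IsLocalRing R] (𝔞 : Ideal R)
    (h𝔞 : 𝔞 ≠ ⊤) (M : DerivedCategory.Plus (ModuleCat.{u} R)) :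
    Nonempty ((RHom (resField R)).obj ((RGamma 𝔞).obj M) ≅ (RHom (resField R)).obj M) := by
  obtain ⟨K, hK, ⟨e⟩⟩ := exists_injective_Q_iso M
  obtain ⟨e₁⟩ := nonempty_RGamma_obj_iso 𝔞 e
  obtain ⟨e₂⟩ := nonempty_rightDerivedFunctorPlus_obj_iso (homFrom (resField R))
    (gammaComplexι 𝔞 K) fun n => isIso_homFrom_resField_map_gammaι 𝔞 h𝔞 (K.obj.X n)
  exact ⟨(RHom (resField R)).mapIso e₁ ≪≫ e₂ ≪≫ (RHom (resField R)).mapIso e.symm⟩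

/-- `RHom(k(𝔭), RΓ_𝔞(M)_𝔭) ≅ RHom(k(𝔭), M_𝔭)` over `R_𝔭`, for every prime `𝔭` containing `𝔞`. -/
theorem nonempty_RHom_resField_localize_RGamma_iso [IsNoetherianRing R] (𝔞 𝔭 : Ideal R)
    [𝔭.IsPrime] [HasDerivedCategory.{w'} (ModuleCat.{u} (Localization.AtPrime 𝔭))] (h : 𝔞 ≤ 𝔭)
    (M : DerivedCategory.Plus (ModuleCat.{u} R)) :
    Nonempty ((RHom (resField (Localization.AtPrime 𝔭))).obj (localize 𝔭 ((RGamma 𝔞).obj M)) ≅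
      (RHom (resField (Localization.AtPrime 𝔭))).obj (localize 𝔭 M)) := by
  obtain ⟨K, hK, ⟨e⟩⟩ := exists_injective_Q_iso M
  obtain ⟨e₁⟩ := nonempty_RGamma_obj_iso 𝔞 e
  obtain ⟨e₂⟩ := nonempty_localize_iso 𝔭 e
  obtain ⟨e₃⟩ := nonempty_localize_iso 𝔭 e₁
  -- Both localized complexes still consist of injectives, because `Γ_𝔞` and localization preserve
  -- them over a Noetherian ring.
  obtain ⟨e₄⟩ := nonempty_rightDerivedFunctorPlus_obj_iso
    (homFrom (resField (Localization.AtPrime 𝔭)))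
    ((ModuleCat.localizedModuleFunctor 𝔭.primeCompl).mapCochainComplexPlus.map
      (gammaComplexι 𝔞 K))
    fun n => isIso_homFrom_resField_map_localized_gammaι 𝔞 𝔭 h (K.obj.X n)
  exact ⟨(RHom _).mapIso e₃ ≪≫ e₄ ≪≫ (RHom _).mapIso e₂.symm⟩

end Derived

end LocalSection

theorem mainTheorem12 {R : Type u} [CommRing R] [IsNoetherianRing R] [IsLocalRing R]
    [HasDerivedCategory.{w} (ModuleCat.{u} R)]
    (𝔞 : Ideal R) (h𝔞 : 𝔞 ≠ ⊤) (M : DerivedCategory.Plus (ModuleCat.{u} R)) :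
    Nonempty
      (DerivedCategory.Plus.ι.obj ((LocalSection.RHom (LocalSection.resField R)).obj
          ((LocalSection.RGamma 𝔞).obj M)) ≅
        DerivedCategory.Plus.ι.obj ((LocalSection.RHom (LocalSection.resField R)).obj M)) ∧
    LocalSection.depth ((LocalSection.RGamma 𝔞).obj M) = LocalSection.depth M ∧
    (∀ i : ℤ, LocalSection.bassNumber ((LocalSection.RGamma 𝔞).obj M) i =
      LocalSection.bassNumber M i) ∧
    (∀ (𝔭 : Ideal R) [𝔭.IsPrime]
      [HasDerivedCategory.{w'} (ModuleCat.{u} (Localization.AtPrime 𝔭))], 𝔞 ≤ 𝔭 → ∀ i : ℤ,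
      LocalSection.bassNumberAt 𝔭 ((LocalSection.RGamma 𝔞).obj M) i =
        LocalSection.bassNumberAt 𝔭 M i) := by
  obtain ⟨e⟩ := LocalSection.nonempty_RHom_resField_RGamma_iso 𝔞 h𝔞 M
  refine ⟨⟨DerivedCategory.Plus.ι.mapIso e⟩, LocalSection.depth_eq_of_iso e,
    LocalSection.bassNumber_eq_of_iso e, fun 𝔭 _ _ h i => ?_⟩
  obtain ⟨e'⟩ := LocalSection.nonempty_RHom_resField_localize_RGamma_iso 𝔞 𝔭 h M
  exact LocalSection.bassNumber_eq_of_iso e' i
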